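/- Setting. Let $V$ be a finite set of spins, each with Hilbert space $\mathbb C^d$, and let $\|\cdot\|$ denote the operator norm. Let $H=\sum_{X\subseteq V,\ |X|\le k}h_X$ be a $k$-local Hamiltonian: each $h_X$ is Hermitian and supported on $X$, and $\sum_{X\ni i}\|h_X\|\le g$ for every $i\in V$. Suppose that $H$ has a unique ground state: its lowest eigenvalue $E_0$ is simple, with unit eigenvector $|\Omega\rangle$. Let $E_1>E_0$ be the next eigenvalue and $\delta E=E_1-E_0$ the spectral gap. Denote by $\rho_i$ and $\rho_{ij}$ the one- and two-spin reduced density matrices of $|\Omega\rangle\langle\Omega|$. (1) Mean-field bound. There is a constant $C>0$ depending only on $d$, $k$, $g$ such that, for all $V$, $H$, $|\Omega\rangle$ as above, every subset $L\subseteq V$ and every spin $i\in V\setminus L$, $$\sum_{j\in L}\|\rho_{ij}-\rho_i\otimes\rho_j\|\le C\sqrt{|L|/\delta E}.$$ (2) Energy density. There is a constant $C>0$ depending only on $d$ and $g$ such that the following holds. Let $k=2$, let $V$ be the vertex set of a graph in which every vertex has exactly $Z$ neighbours (the coordination number), and suppose that $h_X=0$ whenever $|X|=2$ and $X$ is not an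 edge (constants and one-spin terms are allowed). Write $h_{ij}=h_{\{i,j\}}$ for adjacent $i,j$, and put $\langle h_{ij}\rangle_{\rm exact}=\langle\Omega|h_{ij}|\Omega\rangle$ and $\langle h_{ij}\rangle_{\rm MF}=\operatorname{Tr}[h_{ij}\,(\rho_i\otimes\rho_j)]$. Then for every spin $i$, with sums over the neighbours $j$ of $i$, $$\Bigl|\frac1Z\sum_{j\sim i}\langle h_{ij}\rangle_{\rm MF}-\frac1Z\sum_{j\sim i}\langle h_{ij}\rangle_{\rm exact}\Bigr|\le\frac{C}{\sqrt{Z\,\delta E}},$$ and moreover, if $\|h_{ij}\|\le J$ for all neighbours $j$ of $i$, the left-hand side is at most $C\,J/\sqrt{Z\,\delta E}$. -/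

import Mathlib

open scoped Matrix.Norms.L2Operator Kronecker

/-! Finite systems of spins. The spins are labelled by a finite type `V`; each of them has the
Hilbert space `ℂ^d` with standard basis labelled by `Fin d`. The basis of the Hilbert space of the
whole system is labelled by the configurations `V → Fin d`, its vectors are functions
`(V → Fin d) → ℂ`, and its operators are square matrices indexed by configurations.
The norm of every matrix is the operator norm for the Euclidean norm. -/

namespace SpinSystem

/-- The operator `M` is supported on `X`: `M = a ⊗ 1` for an operator `a` on the spins of `X` and
the identity on the other spins. -/
def SupportedOn {V : Type*} {d : ℕ} (X : Finset V)
    (M : Matrix (V → Fin d) (V → Fin d) ℂ) : Prop :=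
  open Classical in
  ∃ a : Matrix (X → Fin d) (X → Fin d) ℂ, ∀ σ τ : V → Fin d,
    M σ τ = if ∀ v, v ∉ X → σ v = τ v then a (fun v => σ v) (fun v => τ v) else 0

/-- A `k`-local Hamiltonian `H = ∑_{|X| ≤ k} h_X` in which the interactions of each spin have
total strength at most `g`, that is `∑_{X ∋ i} ‖h_X‖ ≤ g` for every spin `i`. -/
structure LocalHamiltonian (V : Type*) [Fintype V] [DecidableEq V] (d k : ℕ) (g : ℝ) where
  /-- The interaction terms `h_X`. -/
  term : Finset V → Matrix (V → Fin d) (V → Fin d) ℂ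
  isHermitian_term : ∀ X, (term X).IsHermitian
  supportedOn_term : ∀ X, SupportedOn X (term X)
  term_eq_zero : ∀ X, k < X.card → term X = 0
  strength_le : ∀ i : V, ∑ X : Finset V with i ∈ X, ‖term X‖ ≤ g

/-- The total Hamiltonian `H = ∑_X h_X`. -/
noncomputable def LocalHamiltonian.total {V : Type*} [Fintype V] [DecidableEq V] {d k : ℕ} {g : ℝ}
    (h : LocalHamiltonian V d k g) : Matrix (V → Fin d) (V → Fin d) ℂ :=
  ∑ X : Finset V, h.term X

/-- `Ω` is the normalized unique ground state of `H`, with spectral gap `δE`: the smallest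
eigenvalue `E₀` of `H` is simple with unit eigenvector `Ω`, and the smallest of the other
eigenvalues is `E₁ = E₀ + δE`. -/
structure IsUniqueGroundState {n : Type*} [Fintype n] [DecidableEq n]
    (H : Matrix n n ℂ) (Ω : n → ℂ) (E₀ δE : ℝ) : Prop where
  normalized : star Ω ⬝ᵥ Ω = 1
  isLeast : IsLeast (spectrum ℝ H) E₀
  eigenvector : H.mulVec Ω = (E₀ : ℂ) • Ω
  unique : ∀ ψ : n → ℂ, H.mulVec ψ = (E₀ : ℂ) • ψ → ∃ c : ℂ, ψ = c • Ω
  isLeast_excited : IsLeast (spectrum ℝ H \ {E₀}) (E₀ + δE)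

/-- The expectation value `⟨Ω|M|Ω⟩`. -/
noncomputable def expectation {n : Type*} [Fintype n] (Ω : n → ℂ) (M : Matrix n n ℂ) : ℂ :=
  star Ω ⬝ᵥ M.mulVec Ω

/-- The one-spin reduced density matrix `ρ_i` of `|Ω⟩⟨Ω|` (partial trace over all other spins). -/
noncomputable def rho₁ {V : Type*} [Fintype V] [DecidableEq V] {d : ℕ}
    (Ω : (V → Fin d) → ℂ) (i : V) : Matrix (Fin d) (Fin d) ℂ :=
  Matrix.of fun a b =>
    ∑ σ : V → Fin d with σ i = a, Ω σ * star (Ω (Function.update σ i b))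

/-- The two-spin reduced density matrix `ρ_ij` of `|Ω⟩⟨Ω|`, for `i ≠ j` (partial trace over all
other spins). -/
noncomputable def rho₂ {V : Type*} [Fintype V] [DecidableEq V] {d : ℕ}
    (Ω : (V → Fin d) → ℂ) (i j : V) : Matrix (Fin d × Fin d) (Fin d × Fin d) ℂ :=
  Matrix.of fun a b =>
    ∑ σ : V → Fin d with σ i = a.1 ∧ σ j = a.2,
      Ω σ * star (Ω (Function.update (Function.update σ i b.1) j b.2))

/-- The operator on the whole system that acts as the two-spin operator `w` on the spins `i ≠ j`
(first factor on `i`, second factor on `j`) and as the identity on the other spins. -/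
noncomputable def onPair {V : Type*} {d : ℕ} (i j : V)
    (w : Matrix (Fin d × Fin d) (Fin d × Fin d) ℂ) : Matrix (V → Fin d) (V → Fin d) ℂ :=
  open Classical in
  Matrix.of fun σ τ =>
    if ∀ v, v ≠ i → v ≠ j → σ v = τ v then w (σ i, σ j) (τ i, τ j) else 0

/-- The Hamiltonian is nearest-neighbour on the graph `G`: apart from constants and one-spin terms,
only the pairs of adjacent spins interact. -/
def LocalHamiltonian.IsNearestNeighbour {V : Type*} [Fintype V] [DecidableEq V] {d : ℕ} {g : ℝ}
    (h : LocalHamiltonian V d 2 g) (G : SimpleGraph V) : Prop :=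
  ∀ X, h.term X ≠ 0 → X.card ≤ 1 ∨ ∃ i j, G.Adj i j ∧ X = {i, j}

/-- The mean-field value `⟨w⟩_MF = Tr[w (ρ_i ⊗ ρ_j)]` of the two-spin operator `w` on `i, j`. -/
noncomputable def meanField {V : Type*} [Fintype V] [DecidableEq V] {d : ℕ}
    (Ω : (V → Fin d) → ℂ) (i j : V) (w : Matrix (Fin d × Fin d) (Fin d × Fin d) ℂ) : ℂ :=
  (w * (rho₁ Ω i ⊗ₖ rho₁ Ω j)).trace

end SpinSystem

/-!
The proof rests on the fact that a sum `A = ∑_{j ∈ L} A_j` of one-spin operators with `‖A_j‖ ≤ 1`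
has a ground state fluctuation `‖(A - ⟨A⟩) Ω‖` of order `√(|L| / δE)`, whereas a norm bound only
gives `|L|`. It follows from the inequality
`δE ‖(A - ⟨A⟩) Ω‖² ≤ ⟨Ω|[A†, [H, A]]|Ω⟩` (`IsUniqueGroundState.gap_mul_variance_le`), in which
the right-hand side is the sum of the excitation energies of `(A - ⟨A⟩) Ω` and `(A - ⟨A⟩)† Ω`; the
first is estimated by the gap and the second by zero.

The double commutator is extensive. In `[A†, [h_X, A]]` only the spins of `L ∩ X` matter, so its
norm is at most `4 |L ∩ X|² ‖h_X‖ ≤ 4 k |L ∩ X| ‖h_X‖`, and summation over `X` gives at most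
`4 k g |L|` (`LocalHamiltonian.norm_doubleCommutator_siteSum_le`).

The entries of `ρ_ij - ρ_i ⊗ ρ_j` are the covariances of matrix units on the spins `i` and `j`. With
phases `s_j` that make the covariances positive, the sum over `j ∈ L` of the absolute values of one
entry is the covariance of a matrix unit on `i` with `∑_j s_j A_j`, where the `A_j` are matrix
units. By the Cauchy-Schwarz inequality it is at most the fluctuation of that sum
(`IsUniqueGroundState.sum_norm_entry_le`). Adding up the `d⁴` entries proves the mean-field bound.

The difference of the two energies of an edge is the trace of the two-spin interaction against
`ρ_i ⊗ ρ_j - ρ_ij`, so the same estimate with `L` the set of neighbours of `i` bounds the difference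
of the energy densities (`IsUniqueGroundState.norm_energy_density_sub_le`).
-/

namespace SpinSystem

open Matrix

/-! ### Norms and entries of matrices -/

section Entries

variable {m : Type*} [Fintype m] [DecidableEq m]

theorem norm_entry_le_norm (M : Matrix m m ℂ) (a b : m) : ‖M a b‖ ≤ ‖M‖ := by
  have h := l2_opNorm_mulVec M (EuclideanSpace.single b 1)
  have h2 := PiLp.norm_apply_le
    ((EuclideanSpace.equiv m ℂ).symm (M *ᵥ (EuclideanSpace.single b (1 : ℂ)).ofLp)) a
  have h3 := h2.trans h
  simpa using h3

theorem norm_le_sum_norm_entries (M : Matrix m m ℂ) : ‖M‖ ≤ ∑ a, ∑ b, ‖M a b‖ := by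
  have hs (a b : m) : ‖Matrix.single a b (1 : ℂ)‖ ≤ 1 := by
    have h2 := l2_opNorm_conjTranspose_mul_self (Matrix.single a b (1 : ℂ))
    have h : (Matrix.single a b (1 : ℂ))ᴴ * Matrix.single a b (1 : ℂ) =
        diagonal (Pi.single b 1) := by
      simp [conjTranspose_single, diagonal_single]
    rw [h, l2_opNorm_diagonal, Pi.norm_single, norm_one] at h2
    nlinarith [norm_nonneg (Matrix.single a b (1 : ℂ))]
  calc ‖M‖ = ‖∑ a, ∑ b, M a b • Matrix.single a b (1 : ℂ)‖ := by
        congr 1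
        conv_lhs => rw [matrix_eq_sum_single M]
        simp [smul_single]
    _ ≤ ∑ a, ∑ b, ‖M a b‖ := by
        refine norm_sum_le_of_le _ fun a _ => norm_sum_le_of_le _ fun b _ => ?_
        rw [norm_smul]
        exact mul_le_of_le_one_right (norm_nonneg _) (hs a b)

end Entries

/-! ### Expectation values -/

section Expectation

variable {n : Type*} [Fintype n]

theorem expectation_eq_inner (Ω : n → ℂ) (M : Matrix n n ℂ) :
    expectation Ω M = inner ℂ (WithLp.toLp 2 Ω) (WithLp.toLp 2 (M *ᵥ Ω)) := by
  rw [EuclideanSpace.inner_eq_star_dotProduct, expectation, dotProduct_comm]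

theorem expectation_add (Ω : n → ℂ) (M N : Matrix n n ℂ) :
    expectation Ω (M + N) = expectation Ω M + expectation Ω N := by
  simp [expectation, add_mulVec, dotProduct_add]

theorem expectation_sub (Ω : n → ℂ) (M N : Matrix n n ℂ) :
    expectation Ω (M - N) = expectation Ω M - expectation Ω N := by
  simp [expectation, sub_mulVec, dotProduct_sub]

theorem expectation_smul (Ω : n → ℂ) (c : ℂ) (M : Matrix n n ℂ) :
    expectation Ω (c • M) = c * expectation Ω M := by
  simp [expectation, smul_mulVec, dotProduct_smul]

theorem expectation_sum {ι : Type*} (Ω : n → ℂ) (s : Finset ι) (M : ι → Matrix n n ℂ) :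
    expectation Ω (∑ j ∈ s, M j) = ∑ j ∈ s, expectation Ω (M j) := by
  simp [expectation, sum_mulVec, dotProduct_sum]

theorem expectation_conjTranspose_mul_mul (Ω : n → ℂ) (A M : Matrix n n ℂ) :
    expectation Ω (Aᴴ * M * A) = expectation (A *ᵥ Ω) M := by
  simp only [expectation, ← mulVec_mulVec, star_mulVec, dotProduct_mulVec, vecMul_vecMul]

theorem norm_toLp_eq_one {Ω : n → ℂ} (hΩ : star Ω ⬝ᵥ Ω = 1) : ‖WithLp.toLp 2 Ω‖ = 1 := by
  have h : (inner ℂ (WithLp.toLp 2 Ω) (WithLp.toLp 2 Ω) : ℂ) = 1 := by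
    rw [EuclideanSpace.inner_eq_star_dotProduct, dotProduct_comm]; exact hΩ
  rw [inner_self_eq_norm_sq_to_K] at h
  have h2 : ‖WithLp.toLp 2 Ω‖ ^ 2 = 1 := by
    apply Complex.ofReal_injective
    push_cast
    exact h
  nlinarith [norm_nonneg (WithLp.toLp 2 Ω)]

variable [DecidableEq n]

theorem expectation_one_eq_norm_sq (φ : n → ℂ) :
    expectation φ 1 = ((‖WithLp.toLp 2 φ‖ ^ 2 : ℝ) : ℂ) := by
  rw [expectation_eq_inner, one_mulVec, inner_self_eq_norm_sq_to_K]
  push_cast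
  rfl

theorem norm_expectation_mul_le {Ω : n → ℂ} (hΩ : star Ω ⬝ᵥ Ω = 1) (P B : Matrix n n ℂ) :
    ‖expectation Ω (P * B)‖ ≤ ‖P‖ * ‖WithLp.toLp 2 (B *ᵥ Ω)‖ := by
  rw [expectation_eq_inner, ← mulVec_mulVec]
  refine (norm_inner_le_norm _ _).trans ?_
  rw [norm_toLp_eq_one hΩ, one_mul]
  exact l2_opNorm_mulVec P (WithLp.toLp 2 (B *ᵥ Ω))

theorem norm_expectation_le {Ω : n → ℂ} (hΩ : star Ω ⬝ᵥ Ω = 1) (P : Matrix n n ℂ) :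
    ‖expectation Ω P‖ ≤ ‖P‖ := by
  have h := norm_expectation_mul_le hΩ P 1
  rwa [mul_one, one_mulVec, norm_toLp_eq_one hΩ, mul_one] at h

end Expectation

/-! ### The gap and the double commutator -/

section DoubleCommutator

variable {n : Type*} [Fintype n]

/-- The double commutator `[A†, [M, A]]`. -/
def doubleCommutator (M A : Matrix n n ℂ) : Matrix n n ℂ :=
  Aᴴ * (M * A - A * M) - (M * A - A * M) * Aᴴ

theorem norm_doubleCommutator_le [DecidableEq n] (M A : Matrix n n ℂ) :
    ‖doubleCommutator M A‖ ≤ 4 * ‖A‖ ^ 2 * ‖M‖ := by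
  have h1 : ‖M * A - A * M‖ ≤ 2 * (‖A‖ * ‖M‖) := by
    refine (norm_sub_le _ _).trans ?_
    have := norm_mul_le M A
    have := norm_mul_le A M
    linarith [mul_comm ‖M‖ ‖A‖]
  have hA : ‖Aᴴ‖ = ‖A‖ := l2_opNorm_conjTranspose A
  have h2 := norm_mul_le Aᴴ (M * A - A * M)
  have h3 := norm_mul_le (M * A - A * M) Aᴴ
  have h4 := norm_sub_le (Aᴴ * (M * A - A * M)) ((M * A - A * M) * Aᴴ)
  rw [hA] at h2 h3
  have h5 := mul_le_mul_of_nonneg_left h1 (norm_nonneg A)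
  rw [doubleCommutator]
  nlinarith

theorem doubleCommutator_sum_left {ι : Type*} (s : Finset ι) (M : ι → Matrix n n ℂ)
    (A : Matrix n n ℂ) :
    doubleCommutator (∑ X ∈ s, M X) A = ∑ X ∈ s, doubleCommutator (M X) A := by
  simp only [doubleCommutator, Finset.sum_mul, Finset.mul_sum, Finset.sum_sub_distrib, mul_sub,
    sub_mul]

theorem doubleCommutator_add_right {M B R : Matrix n n ℂ} (hMR : Commute M R)
    (hMR' : Commute M Rᴴ) (hBR' : Commute B Rᴴ) :
    doubleCommutator M (B + R) = doubleCommutator M B := by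
  have h1 : M * (B + R) - (B + R) * M = M * B - B * M := by
    rw [mul_add, add_mul, hMR.eq]
    abel
  have h2 : Commute (M * B - B * M) Rᴴ :=
    (hMR'.mul_left hBR').sub_left (hBR'.mul_left hMR')
  rw [doubleCommutator, doubleCommutator, h1, conjTranspose_add, add_mul, mul_add, h2.eq]
  abel

end DoubleCommutator

section Gap

variable {n : Type*} [Fintype n] [DecidableEq n]

theorem expectation_eq_sum_eigenvalues {H : Matrix n n ℂ} (hH : H.IsHermitian) (φ : n → ℂ) :
    expectation φ H = ((∑ j, hH.eigenvalues j *
      ‖(inner ℂ (hH.eigenvectorBasis j) (WithLp.toLp 2 φ) : ℂ)‖ ^ 2 : ℝ) : ℂ) := by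
  rw [expectation_eq_inner, ← hH.eigenvectorBasis.sum_inner_mul_inner]
  push_cast
  refine Finset.sum_congr rfl fun j _ => ?_
  have h : (inner ℂ (hH.eigenvectorBasis j) (WithLp.toLp 2 (H *ᵥ φ)) : ℂ) =
      hH.eigenvalues j * inner ℂ (hH.eigenvectorBasis j) (WithLp.toLp 2 φ) := by
    rw [EuclideanSpace.inner_eq_star_dotProduct, EuclideanSpace.inner_eq_star_dotProduct,
      dotProduct_comm, dotProduct_mulVec, dotProduct_comm]
    have h2 : star (hH.eigenvectorBasis j).ofLp ᵥ* H =
        (hH.eigenvalues j : ℂ) • star (hH.eigenvectorBasis j).ofLp := by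
      have h3 := congrArg star (hH.mulVec_eigenvectorBasis j)
      rw [star_mulVec, hH.eq] at h3
      rw [h3]
      ext x
      simp
    rw [h2, dotProduct_smul, smul_eq_mul]
  rw [h, ← inner_conj_symm, mul_left_comm, Complex.conj_mul']

theorem IsUniqueGroundState.gap_pos {H : Matrix n n ℂ} {Ω : n → ℂ} {E₀ δE : ℝ}
    (h : IsUniqueGroundState H Ω E₀ δE) : 0 < δE := by
  have h1 := h.isLeast.2 h.isLeast_excited.1.1
  have h2 : E₀ + δE ≠ E₀ := h.isLeast_excited.1.2
  rcases lt_or_eq_of_le h1 with h3 | h3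
  · linarith
  · exact absurd h3.symm h2

/-- The variational principle: no vector has energy below `E₀`. -/
theorem IsUniqueGroundState.groundEnergy_le_expectation {H : Matrix n n ℂ} (hH : H.IsHermitian)
    {Ω : n → ℂ} {E₀ δE : ℝ} (h : IsUniqueGroundState H Ω E₀ δE) (φ : n → ℂ) :
    E₀ * ‖WithLp.toLp 2 φ‖ ^ 2 ≤ (expectation φ H).re := by
  rw [expectation_eq_sum_eigenvalues hH, Complex.ofReal_re,
    ← hH.eigenvectorBasis.sum_sq_norm_inner_right, Finset.mul_sum]
  exact Finset.sum_le_sum fun j _ => mul_le_mul_of_nonneg_right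
    (h.isLeast.2 (hH.eigenvalues_mem_spectrum_real j)) (sq_nonneg _)

/-- The variational characterization of the gap: vectors orthogonal to the ground state have
energy at least `E₀ + δE`. -/
theorem IsUniqueGroundState.gap_le_expectation {H : Matrix n n ℂ} (hH : H.IsHermitian)
    {Ω : n → ℂ} {E₀ δE : ℝ} (h : IsUniqueGroundState H Ω E₀ δE) (φ : n → ℂ)
    (hφ : star Ω ⬝ᵥ φ = 0) :
    (E₀ + δE) * ‖WithLp.toLp 2 φ‖ ^ 2 ≤ (expectation φ H).re := by
  rw [expectation_eq_sum_eigenvalues hH, Complex.ofReal_re,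
    ← hH.eigenvectorBasis.sum_sq_norm_inner_right, Finset.mul_sum]
  refine Finset.sum_le_sum fun j _ => ?_
  by_cases hj : hH.eigenvalues j = E₀
  · -- An eigenvector for `E₀` is a multiple of `Ω`, hence orthogonal to `φ`.
    obtain ⟨c, hc⟩ := h.unique (hH.eigenvectorBasis j).ofLp (by
      rw [hH.mulVec_eigenvectorBasis, hj]
      ext x
      simp)
    have h0 : (inner ℂ (hH.eigenvectorBasis j) (WithLp.toLp 2 φ) : ℂ) = 0 := by
      rw [EuclideanSpace.inner_eq_star_dotProduct, hc, star_smul, dotProduct_smul,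
        dotProduct_comm, hφ, smul_zero]
    simp [h0]
  · exact mul_le_mul_of_nonneg_right
      (h.isLeast_excited.2 ⟨hH.eigenvalues_mem_spectrum_real j, hj⟩) (sq_nonneg _)

/-- The gap turns a bound on the double commutator `[A†, [H, A]]` into a bound on the fluctuation
of `A` in the ground state. Up to the shift of `A` by its mean, the expectation of the double
commutator is the sum of the excitation energies of `A Ω` and `A† Ω`; the second is nonnegative
and the first is at least `δE` times the squared norm. -/
theorem IsUniqueGroundState.gap_mul_variance_le {H : Matrix n n ℂ} (hH : H.IsHermitian)
    {Ω : n → ℂ} {E₀ δE : ℝ} (h : IsUniqueGroundState H Ω E₀ δE) (A : Matrix n n ℂ) :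
    δE * ‖WithLp.toLp 2 ((A - expectation Ω A • 1) *ᵥ Ω)‖ ^ 2 ≤
      ‖doubleCommutator H A‖ := by
  set B := A - expectation Ω A • (1 : Matrix n n ℂ) with hB
  set K := H - (E₀ : ℂ) • (1 : Matrix n n ℂ) with hK
  have hKh : Kᴴ = K := by simp [hK, hH.eq]
  have hKΩ : K *ᵥ Ω = 0 := by simp [hK, sub_mulVec, h.eigenvector, smul_mulVec]
  -- Shifts of `A` and `H` by scalars do not change the commutators, and `K` annihilates `Ω`.
  have hD : doubleCommutator H A =
      Bᴴ * K * B + Bᴴᴴ * K * Bᴴ - Bᴴ * B * K - K * (B * Bᴴ) := by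
    have hA : A = B + expectation Ω A • (1 : Matrix n n ℂ) := by simp [hB]
    have hH' : H = K + (E₀ : ℂ) • (1 : Matrix n n ℂ) := by simp [hK]
    have hAs : Aᴴ = Bᴴ + star (expectation Ω A) • (1 : Matrix n n ℂ) := by simp [hB]
    have hc : H * A - A * H = K * B - B * K := by
      simp only [hB, hK, mul_sub, sub_mul, Matrix.mul_smul, Matrix.smul_mul, mul_one, one_mul,
        smul_smul, mul_comm]
      abel
    rw [doubleCommutator, hc, hAs, conjTranspose_conjTranspose]
    simp only [mul_sub, sub_mul, mul_add, add_mul, Matrix.mul_smul, Matrix.smul_mul, mul_one,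
      one_mul, mul_assoc]
    abel
  have h1 : expectation Ω (Bᴴ * B * K) = 0 := by
    simp [expectation, ← mulVec_mulVec, hKΩ]
  have h2 : expectation Ω (K * (B * Bᴴ)) = 0 := by
    have : star Ω ᵥ* K = 0 := by
      have := congrArg star hKΩ
      rwa [star_mulVec, hKh, star_zero] at this
    rw [expectation, ← mulVec_mulVec, dotProduct_mulVec, this, zero_dotProduct]
  have hKexp (φ : n → ℂ) : (expectation φ K).re =
      (expectation φ H).re - E₀ * ‖WithLp.toLp 2 φ‖ ^ 2 := by
    rw [hK, expectation_sub, expectation_smul, expectation_one_eq_norm_sq, Complex.sub_re,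
      ← Complex.ofReal_mul, Complex.ofReal_re]
  have hBΩ : star Ω ⬝ᵥ (B *ᵥ Ω) = 0 := by
    change expectation Ω B = 0
    rw [hB, expectation_sub, expectation_smul, expectation_one_eq_norm_sq,
      norm_toLp_eq_one h.normalized]
    simp
  have h3 := h.gap_le_expectation hH (B *ᵥ Ω) hBΩ
  have h4 := h.groundEnergy_le_expectation hH (Bᴴ *ᵥ Ω)
  have h5 := norm_expectation_le h.normalized (doubleCommutator H A)
  refine le_trans ?_ ((Complex.re_le_norm _).trans h5)
  rw [hD, expectation_sub, expectation_sub, expectation_add, h1, h2, sub_zero, sub_zero,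
    expectation_conjTranspose_mul_mul, expectation_conjTranspose_mul_mul, Complex.add_re,
    hKexp, hKexp]
  linarith

end Gap

/-! ### Matrix units on single spins -/

section SiteUnit

variable {V : Type*} [DecidableEq V] {d : ℕ}

theorem eq_update_symm (i : V) (a b : Fin d) (σ τ : V → Fin d) :
    σ i = b ∧ τ = Function.update σ i a ↔ τ i = a ∧ σ = Function.update τ i b := by
  constructor
  · rintro ⟨rfl, rfl⟩
    simp
  · rintro ⟨rfl, rfl⟩
    simp

theorem update_update_update_update {i j : V} (hij : i ≠ j) (σ : V → Fin d) (a b : Fin d) :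
    Function.update (Function.update (Function.update (Function.update σ i a) j b) i (σ i)) j
      (σ j) = σ := by
  ext v
  by_cases hj : v = j
  · subst hj; simp
  · by_cases hi : v = i
    · subst hi; simp [hj]
    · simp [hi, hj]

theorem onPair_update {i j : V} (hij : i ≠ j) (w : Matrix (Fin d × Fin d) (Fin d × Fin d) ℂ)
    (σ : V → Fin d) (b : Fin d × Fin d) :
    onPair i j w σ (Function.update (Function.update σ i b.1) j b.2) = w (σ i, σ j) b := by
  have h : ∀ v, v ≠ i → v ≠ j → σ v = Function.update (Function.update σ i b.1) j b.2 v := by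
    intro v hi hj
    simp [hi, hj]
  simp only [onPair, of_apply, if_pos h, Function.update_self, Function.update_of_ne hij]

variable [Fintype V]

/-- The matrix unit `|b⟩⟨a|` acting on the spin `i`, with the identity on the other spins. -/
def siteUnit (i : V) (b a : Fin d) : Matrix (V → Fin d) (V → Fin d) ℂ :=
  Matrix.of fun σ τ => if σ i = b ∧ τ = Function.update σ i a then 1 else 0

theorem conjTranspose_siteUnit (i : V) (b a : Fin d) : (siteUnit i b a)ᴴ = siteUnit i a b := by
  ext σ τ
  simp only [conjTranspose_apply, siteUnit, of_apply, eq_update_symm i b a σ τ]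
  split_ifs <;> simp

theorem supportedOn_siteUnit (i : V) (b a : Fin d) : SupportedOn {i} (siteUnit i b a) := by
  refine ⟨Matrix.of fun s t => if s ⟨i, by simp⟩ = b ∧ t ⟨i, by simp⟩ = a then 1 else 0,
    fun σ τ => ?_⟩
  simp only [siteUnit, of_apply, ← ite_and]
  congr 1
  apply propext
  constructor
  · rintro ⟨rfl, rfl⟩
    exact ⟨fun v hv => by rw [Function.update_of_ne (by simpa using hv)], by simp⟩
  · rintro ⟨h, rfl, rfl⟩
    refine ⟨rfl, ?_⟩
    ext v
    by_cases hv : v = i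
    · subst hv; simp
    · rw [Function.update_of_ne hv, h v (by simpa using hv)]

theorem siteUnit_mul_apply (i : V) (b a : Fin d) (M : Matrix (V → Fin d) (V → Fin d) ℂ)
    (σ τ : V → Fin d) :
    (siteUnit i b a * M) σ τ = if σ i = b then M (Function.update σ i a) τ else 0 := by
  by_cases h : σ i = b <;> simp [siteUnit, mul_apply, h]

theorem mul_siteUnit_apply (i : V) (b a : Fin d) (M : Matrix (V → Fin d) (V → Fin d) ℂ)
    (σ τ : V → Fin d) :
    (M * siteUnit i b a) σ τ = if τ i = a then M σ (Function.update τ i b) else 0 := by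
  by_cases h : τ i = a <;> simp [siteUnit, mul_apply, eq_update_symm, h]

theorem siteUnit_mulVec (i : V) (b a : Fin d) (Ω : (V → Fin d) → ℂ) (σ : V → Fin d) :
    (siteUnit i b a *ᵥ Ω) σ = if σ i = b then Ω (Function.update σ i a) else 0 := by
  by_cases h : σ i = b <;> simp [siteUnit, mulVec, dotProduct, h]

theorem norm_siteUnit_le (i : V) (b a : Fin d) : ‖siteUnit i b a‖ ≤ 1 := by
  have h : (siteUnit i b a)ᴴ * siteUnit i b a =
      diagonal fun σ : V → Fin d => if σ i = a then (1 : ℂ) else 0 := by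
    ext σ τ
    rw [conjTranspose_siteUnit, siteUnit_mul_apply, diagonal_apply]
    by_cases h1 : σ i = a
    · subst h1
      simp [siteUnit, eq_comm]
    · simp [h1]
  have h2 := l2_opNorm_conjTranspose_mul_self (siteUnit i b a)
  rw [h, l2_opNorm_diagonal] at h2
  have h3 : ‖fun σ : V → Fin d => if σ i = a then (1 : ℂ) else 0‖ ≤ 1 := by
    rw [pi_norm_le_iff_of_nonneg zero_le_one]
    intro σ
    split_ifs <;> simp
  nlinarith [norm_nonneg (siteUnit i b a)]

/-- An operator supported on `X` commutes with the operators of a spin outside `X`. -/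
theorem SupportedOn.commute_siteUnit {X : Finset V} {M : Matrix (V → Fin d) (V → Fin d) ℂ}
    (hM : SupportedOn X M) {i : V} (hi : i ∉ X) (b a : Fin d) : Commute M (siteUnit i b a) := by
  classical
  obtain ⟨m, hm⟩ := hM
  ext σ τ
  have hX (ρ : V → Fin d) (c : Fin d) :
      (fun v : X => Function.update ρ i c v) = fun v : X => ρ v := by
    ext v
    rw [Function.update_of_ne]
    rintro rfl
    exact hi v.2
  rw [mul_siteUnit_apply, siteUnit_mul_apply, hm, hm, hX, hX, ← ite_and, ← ite_and]
  congr 1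
  apply propext
  constructor
  · rintro ⟨rfl, h⟩
    refine ⟨by simpa using h i hi, fun v hv => ?_⟩
    by_cases hvi : v = i
    · subst hvi; simp
    · simpa [hvi] using h v hv
  · rintro ⟨rfl, h⟩
    refine ⟨by simpa using (h i hi).symm, fun v hv => ?_⟩
    by_cases hvi : v = i
    · subst hvi; simp
    · simpa [hvi] using h v hv

theorem siteUnit_mul_siteUnit_apply {i j : V} (hij : i ≠ j) (b a c e : Fin d)
    (σ τ : V → Fin d) :
    (siteUnit i b a * siteUnit j c e) σ τ =
      if (σ i = b ∧ σ j = c) ∧ τ = Function.update (Function.update σ i a) j e then 1 else 0 := by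
  rw [siteUnit_mul_apply, siteUnit, of_apply, Function.update_of_ne hij.symm, ← ite_and]
  simp only [and_assoc]

/-- The entry `a b` of `ρ_i` is the expectation of the transposed matrix unit `|b⟩⟨a|`. -/
theorem expectation_siteUnit (Ω : (V → Fin d) → ℂ) (i : V) (a b : Fin d) :
    expectation Ω (siteUnit i b a) = rho₁ Ω i a b := by
  simp only [expectation, dotProduct, siteUnit_mulVec, rho₁, of_apply, Pi.star_apply, mul_ite,
    mul_zero, ← Finset.sum_filter]
  refine Finset.sum_nbij' (fun σ => Function.update σ i a) (fun σ => Function.update σ i b)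
    ?_ ?_ ?_ ?_ ?_
  · simp
  · simp
  · intro σ hσ
    simp [← (Finset.mem_filter.1 hσ).2]
  · intro σ hσ
    simp [← (Finset.mem_filter.1 hσ).2]
  · intro σ hσ
    simp [← (Finset.mem_filter.1 hσ).2, mul_comm]

theorem expectation_siteUnit_mul_siteUnit (Ω : (V → Fin d) → ℂ) {i j : V} (hij : i ≠ j)
    (a b : Fin d × Fin d) :
    expectation Ω (siteUnit i b.1 a.1 * siteUnit j b.2 a.2) = rho₂ Ω i j a b := by
  simp only [expectation, dotProduct, ← mulVec_mulVec, siteUnit_mulVec, rho₂, of_apply,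
    Pi.star_apply, mul_ite, mul_zero, Function.update_of_ne hij.symm, ← ite_and,
    ← Finset.sum_filter]
  refine Finset.sum_nbij' (fun σ => Function.update (Function.update σ i a.1) j a.2)
    (fun σ => Function.update (Function.update σ i b.1) j b.2) ?_ ?_ ?_ ?_ ?_
  · simp [Function.update_of_ne hij]
  · simp [Function.update_of_ne hij]
  · intro σ hσ
    obtain ⟨-, h1, h2⟩ := Finset.mem_filter.1 hσ
    rw [← h1, ← h2, update_update_update_update hij]
  · intro σ hσ
    obtain ⟨-, h1, h2⟩ := Finset.mem_filter.1 hσ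
    rw [← h1, ← h2, update_update_update_update hij]
  · intro σ hσ
    obtain ⟨-, h1, h2⟩ := Finset.mem_filter.1 hσ
    rw [← h1, ← h2, update_update_update_update hij, mul_comm]

/-- A two-spin operator expanded in products of matrix units. -/
theorem onPair_eq_sum {i j : V} (hij : i ≠ j) (w : Matrix (Fin d × Fin d) (Fin d × Fin d) ℂ) :
    onPair i j w = ∑ a, ∑ b, w a b • (siteUnit i a.1 b.1 * siteUnit j a.2 b.2) := by
  ext σ τ
  simp only [Matrix.sum_apply, Matrix.smul_apply, siteUnit_mul_siteUnit_apply hij, smul_eq_mul,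
    mul_ite, mul_one, mul_zero]
  rw [Finset.sum_eq_single (σ i, σ j), Finset.sum_eq_single (τ i, τ j)]
  · simp only [onPair, of_apply, true_and]
    congr 1
    apply propext
    constructor
    · intro h
      ext v
      by_cases hj : v = j
      · subst hj; simp
      · by_cases hi : v = i
        · subst hi; simp [hj]
        · simp [hi, hj, h v hi hj]
    · intro h v hi hj
      rw [h]
      simp [hi, hj]
  · intro b _ hb
    refine if_neg ?_
    rintro ⟨-, rfl⟩
    exact hb (by simp [hij])
  · simp
  · intro a _ ha
    refine Finset.sum_eq_zero fun b _ => if_neg ?_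
    rintro ⟨⟨h1, h2⟩, -⟩
    exact ha (Prod.ext h1.symm h2.symm)
  · simp

theorem expectation_onPair (Ω : (V → Fin d) → ℂ) {i j : V} (hij : i ≠ j)
    (w : Matrix (Fin d × Fin d) (Fin d × Fin d) ℂ) :
    expectation Ω (onPair i j w) = (w * rho₂ Ω i j).trace := by
  simp only [onPair_eq_sum hij, expectation_sum, expectation_smul,
    expectation_siteUnit_mul_siteUnit Ω hij, trace, diag_apply, mul_apply]

end SiteUnit

/-! ### Locality of the double commutator -/

section LocalHamiltonian

variable {V : Type*} [Fintype V] [DecidableEq V] {d k : ℕ} {g : ℝ}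

theorem LocalHamiltonian.isHermitian_total (h : LocalHamiltonian V d k g) :
    h.total.IsHermitian := by
  rw [Matrix.IsHermitian, LocalHamiltonian.total, conjTranspose_sum]
  exact Finset.sum_congr rfl fun X _ => h.isHermitian_term X

theorem LocalHamiltonian.strength_nonneg (h : LocalHamiltonian V d k g) (i : V) : 0 ≤ g :=
  (Finset.sum_nonneg fun _ _ => norm_nonneg _).trans (h.strength_le i)

theorem LocalHamiltonian.norm_term_le (h : LocalHamiltonian V d k g) {i : V} {X : Finset V}
    (hi : i ∈ X) : ‖h.term X‖ ≤ g :=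
  (Finset.single_le_sum (f := fun X => ‖h.term X‖) (fun _ _ => norm_nonneg _)
    (by simpa using hi)).trans (h.strength_le i)

/-- A sum of one-spin matrix units over the spins of `L`, weighted by `s`. -/
noncomputable def siteSum (L : Finset V) (s : V → ℂ) (b a : Fin d) :
    Matrix (V → Fin d) (V → Fin d) ℂ :=
  ∑ j ∈ L, s j • siteUnit j b a

theorem norm_siteSum_le (L : Finset V) {s : V → ℂ} (hs : ∀ j, ‖s j‖ ≤ 1) (b a : Fin d) :
    ‖siteSum L s b a‖ ≤ L.card := by
  refine (norm_sum_le_of_le L fun j _ => ?_).trans (by simp : ∑ _j ∈ L, (1 : ℝ) ≤ L.card)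
  rw [norm_smul]
  exact mul_le_one₀ (hs j) (norm_nonneg _) (norm_siteUnit_le j b a)

theorem conjTranspose_siteSum (L : Finset V) (s : V → ℂ) (b a : Fin d) :
    (siteSum L s b a)ᴴ = siteSum L (star s) a b := by
  simp [siteSum, conjTranspose_sum, conjTranspose_siteUnit]

theorem SupportedOn.commute_siteSum {X : Finset V} {M : Matrix (V → Fin d) (V → Fin d) ℂ}
    (hM : SupportedOn X M) {L : Finset V} (hL : Disjoint L X) (s : V → ℂ) (b a : Fin d) :
    Commute M (siteSum L s b a) :=
  Commute.sum_right _ _ _ fun j hj =>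
    (hM.commute_siteUnit (Finset.disjoint_left.1 hL hj) b a).smul_right (s j)

theorem commute_siteSum_siteSum {K L : Finset V} (hKL : Disjoint K L) (s t : V → ℂ)
    (b a c e : Fin d) : Commute (siteSum K s b a) (siteSum L t c e) :=
  Commute.sum_left _ _ _ fun j hj =>
    ((supportedOn_siteUnit j b a).commute_siteSum
      (Finset.disjoint_singleton_right.2 (Finset.disjoint_left.1 hKL hj)) t c e).smul_left (s j)

/-- Only the spins of `L` inside `X` contribute to the double commutator with a term supported
on `X`. -/
theorem SupportedOn.doubleCommutator_siteSum {X : Finset V}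
    {M : Matrix (V → Fin d) (V → Fin d) ℂ} (hM : SupportedOn X M) (L : Finset V) (s : V → ℂ)
    (b a : Fin d) :
    doubleCommutator M (siteSum L s b a) = doubleCommutator M (siteSum {j ∈ L | j ∈ X} s b a) := by
  have hsplit : siteSum L s b a =
      siteSum {j ∈ L | j ∈ X} s b a + siteSum {j ∈ L | j ∉ X} s b a :=
    (Finset.sum_filter_add_sum_filter_not L (· ∈ X) _).symm
  have hdis : Disjoint {j ∈ L | j ∉ X} X :=
    Finset.disjoint_left.2 fun j hj => (Finset.mem_filter.1 hj).2
  rw [hsplit, doubleCommutator_add_right (hM.commute_siteSum hdis s b a)]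
  · rw [conjTranspose_siteSum]
    exact hM.commute_siteSum hdis _ a b
  · rw [conjTranspose_siteSum]
    exact commute_siteSum_siteSum (Finset.disjoint_filter_filter_not L L _) _ _ _ _ _ _

/-- The double commutator of the Hamiltonian with a sum of one-spin operators is extensive: it
grows linearly, not quadratically, with the number of spins in the sum. -/
theorem LocalHamiltonian.norm_doubleCommutator_siteSum_le (h : LocalHamiltonian V d k g)
    (L : Finset V) {s : V → ℂ} (hs : ∀ j, ‖s j‖ ≤ 1) (b a : Fin d) :
    ‖doubleCommutator h.total (siteSum L s b a)‖ ≤ 4 * k * g * L.card := by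
  have hterm (X : Finset V) : ‖doubleCommutator (h.term X) (siteSum L s b a)‖ ≤
      4 * k * ∑ j ∈ L, if j ∈ X then ‖h.term X‖ else 0 := by
    rw [(h.supportedOn_term X).doubleCommutator_siteSum, ← Finset.sum_filter, Finset.sum_const,
      nsmul_eq_mul]
    set c : ℕ := Finset.card {j ∈ L | j ∈ X} with hc
    refine (norm_doubleCommutator_le _ _).trans ?_
    by_cases hX : k < X.card
    · simp [h.term_eq_zero X hX]
    have hck : (c : ℝ) ≤ k := by
      refine Nat.cast_le.2 (le_trans (Finset.card_le_card ?_) (not_lt.1 hX))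
      intro j hj
      exact (Finset.mem_filter.1 hj).2
    have hA : ‖siteSum {j ∈ L | j ∈ X} s b a‖ ^ 2 ≤ k * c := by
      have h1 := norm_siteSum_le {j ∈ L | j ∈ X} hs b a
      rw [← hc] at h1
      calc _ ≤ (c : ℝ) ^ 2 := pow_le_pow_left₀ (norm_nonneg _) h1 2
        _ = c * c := sq _
        _ ≤ k * c := mul_le_mul_of_nonneg_right hck c.cast_nonneg
    have := mul_le_mul_of_nonneg_right hA (norm_nonneg (h.term X))
    linarith
  calc ‖doubleCommutator h.total (siteSum L s b a)‖
      ≤ ∑ X : Finset V, 4 * k * ∑ j ∈ L, (if j ∈ X then ‖h.term X‖ else 0) := by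
        rw [LocalHamiltonian.total, doubleCommutator_sum_left]
        exact norm_sum_le_of_le _ fun X _ => hterm X
    _ = 4 * k * ∑ j ∈ L, ∑ X : Finset V with j ∈ X, ‖h.term X‖ := by
        rw [← Finset.mul_sum, Finset.sum_comm]
        simp only [Finset.sum_filter]
    _ ≤ 4 * k * ∑ _j ∈ L, g := by
        refine mul_le_mul_of_nonneg_left ?_ (by positivity)
        exact Finset.sum_le_sum fun j _ => h.strength_le j
    _ = 4 * k * g * L.card := by
        rw [Finset.sum_const, nsmul_eq_mul]
        ring

end LocalHamiltonian

/-! ### Correlations in the ground state -/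

section Correlation

variable {V : Type*} [Fintype V] [DecidableEq V] {d k : ℕ} {g : ℝ}

theorem exists_phase (z : ℂ) : ∃ s : ℂ, ‖s‖ ≤ 1 ∧ s * z = ‖z‖ := by
  by_cases hz : z = 0
  · exact ⟨0, by simp, by simp [hz]⟩
  · have hz' : (‖z‖ : ℂ) ≠ 0 := by simpa using hz
    refine ⟨star z / ‖z‖, by simp [hz], ?_⟩
    rw [div_mul_eq_mul_div, div_eq_iff hz']
    change (starRingEnd ℂ) z * z = _
    rw [Complex.conj_mul', sq]

/-- The entries of `ρ_ij - ρ_i ⊗ ρ_j` are the covariances of matrix units on `i` and `j`. Weighting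
them by phases turns the sum of their absolute values into the covariance of a matrix unit on `i`
with a sum of one-spin operators over `L`, which Cauchy-Schwarz bounds by the fluctuation of that
sum. -/
theorem IsUniqueGroundState.sum_norm_entry_le {h : LocalHamiltonian V d k g}
    {Ω : (V → Fin d) → ℂ} {E₀ δE : ℝ} (hΩ : IsUniqueGroundState h.total Ω E₀ δE)
    {L : Finset V} {i : V} (hi : i ∉ L) (a b : Fin d × Fin d) :
    ∑ j ∈ L, ‖(rho₂ Ω i j - (rho₁ Ω i ⊗ₖ rho₁ Ω j)) a b‖ ≤
      Real.sqrt (4 * k * g) * Real.sqrt (L.card / δE) := by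
  choose s hs hsz using fun j => exists_phase ((rho₂ Ω i j - (rho₁ Ω i ⊗ₖ rho₁ Ω j)) a b)
  set P : Matrix (V → Fin d) (V → Fin d) ℂ := siteUnit i b.1 a.1 with hP
  set A := siteSum L s b.2 a.2 with hA
  have hg : 0 ≤ g := h.strength_nonneg i
  have hcov : ((∑ j ∈ L, ‖(rho₂ Ω i j - (rho₁ Ω i ⊗ₖ rho₁ Ω j)) a b‖ : ℝ) : ℂ) =
      expectation Ω (P * (A - expectation Ω A • 1)) := by
    have hmean : expectation Ω A = ∑ j ∈ L, s j * rho₁ Ω j a.2 b.2 := by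
      simp only [hA, siteSum, expectation_sum, expectation_smul, expectation_siteUnit]
    have hPA : expectation Ω (P * A) = ∑ j ∈ L, s j * rho₂ Ω i j a b := by
      simp only [hA, hP, siteSum, Finset.mul_sum, Matrix.mul_smul, expectation_sum,
        expectation_smul]
      refine Finset.sum_congr rfl fun j hj => ?_
      have hij : i ≠ j := fun hij => hi (hij ▸ hj)
      rw [expectation_siteUnit_mul_siteUnit Ω hij]
    rw [mul_sub, Matrix.mul_smul, mul_one, expectation_sub, expectation_smul, hPA, hP,
      expectation_siteUnit, hmean, Finset.sum_mul, ← Finset.sum_sub_distrib]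
    push_cast
    refine Finset.sum_congr rfl fun j _ => ?_
    rw [← hsz, Matrix.sub_apply, kroneckerMap_apply]
    ring
  have hvar : ‖WithLp.toLp 2 ((A - expectation Ω A • 1) *ᵥ Ω)‖ ^ 2 ≤
      4 * k * g * (L.card / δE) := by
    have h1 := (hΩ.gap_mul_variance_le h.isHermitian_total A).trans
      (h.norm_doubleCommutator_siteSum_le L hs b.2 a.2)
    rw [← mul_div_assoc, le_div_iff₀ hΩ.gap_pos]
    linarith
  calc ∑ j ∈ L, ‖(rho₂ Ω i j - (rho₁ Ω i ⊗ₖ rho₁ Ω j)) a b‖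
      = ‖expectation Ω (P * (A - expectation Ω A • 1))‖ := by
        rw [← hcov, Complex.norm_real, Real.norm_of_nonneg]
        exact Finset.sum_nonneg fun _ _ => norm_nonneg _
    _ ≤ 1 * ‖WithLp.toLp 2 ((A - expectation Ω A • 1) *ᵥ Ω)‖ :=
        (norm_expectation_mul_le hΩ.normalized _ _).trans
          (mul_le_mul_of_nonneg_right (norm_siteUnit_le _ _ _) (norm_nonneg _))
    _ ≤ Real.sqrt (4 * k * g * (L.card / δE)) := by
        rw [one_mul]
        exact Real.le_sqrt_of_sq_le hvar
    _ = Real.sqrt (4 * k * g) * Real.sqrt (L.card / δE) := Real.sqrt_mul (by positivity) _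

theorem IsUniqueGroundState.sum_sum_norm_entry_le {h : LocalHamiltonian V d k g}
    {Ω : (V → Fin d) → ℂ} {E₀ δE : ℝ} (hΩ : IsUniqueGroundState h.total Ω E₀ δE)
    {L : Finset V} {i : V} (hi : i ∉ L) :
    ∑ j ∈ L, ∑ a, ∑ b, ‖(rho₂ Ω i j - (rho₁ Ω i ⊗ₖ rho₁ Ω j)) a b‖ ≤
      d ^ 4 * Real.sqrt (4 * k * g) * Real.sqrt (L.card / δE) := by
  rw [Finset.sum_comm]
  calc _ ≤ ∑ _a : Fin d × Fin d, ∑ _b : Fin d × Fin d,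
        Real.sqrt (4 * k * g) * Real.sqrt (L.card / δE) := by
        refine Finset.sum_le_sum fun a _ => ?_
        rw [Finset.sum_comm]
        exact Finset.sum_le_sum fun b _ => hΩ.sum_norm_entry_le hi a b
    _ = _ := by
        simp only [Finset.sum_const, Finset.card_univ, Fintype.card_prod, Fintype.card_fin,
          nsmul_eq_mul]
        push_cast
        ring

theorem norm_entry_le_norm_onPair {i j : V} (hij : i ≠ j)
    (w : Matrix (Fin d × Fin d) (Fin d × Fin d) ℂ) (a b : Fin d × Fin d) :
    ‖w a b‖ ≤ ‖onPair i j w‖ := by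
  have h := onPair_update hij w (Function.update (Function.update (fun _ : V => a.1) i a.1) j a.2) b
  rw [Function.update_of_ne hij, Function.update_self, Function.update_self] at h
  rw [← h]
  exact norm_entry_le_norm _ _ _

/-- Both expectation values are traces against `w`, whose entries are entries of the operator that
`w` induces on the whole system. -/
theorem norm_meanField_sub_expectation_le (Ω : (V → Fin d) → ℂ) {i j : V} (hij : i ≠ j)
    (w : Matrix (Fin d × Fin d) (Fin d × Fin d) ℂ) :
    ‖meanField Ω i j w - expectation Ω (onPair i j w)‖ ≤
      ‖onPair i j w‖ * ∑ a, ∑ b, ‖(rho₂ Ω i j - (rho₁ Ω i ⊗ₖ rho₁ Ω j)) a b‖ := by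
  rw [expectation_onPair Ω hij, meanField, ← trace_sub, ← mul_sub, Finset.sum_comm,
    Finset.mul_sum]
  simp only [Finset.mul_sum, trace, diag_apply, mul_apply]
  refine norm_sum_le_of_le _ fun a _ => norm_sum_le_of_le _ fun b _ => ?_
  rw [norm_mul, Matrix.sub_apply, norm_sub_rev, ← Matrix.sub_apply]
  exact mul_le_mul_of_nonneg_right (norm_entry_le_norm_onPair hij w a b) (norm_nonneg _)

/-- The energy density bound in terms of a common bound `J` on the couplings of `i`. For `Z = 0`
both sides vanish, as division by zero gives zero. -/
theorem IsUniqueGroundState.norm_energy_density_sub_le {h : LocalHamiltonian V d 2 g}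
    {Ω : (V → Fin d) → ℂ} {E₀ δE : ℝ} (hΩ : IsUniqueGroundState h.total Ω E₀ δE)
    {G : SimpleGraph V} [DecidableRel G.Adj] {Z : ℕ} (hG : G.IsRegularOfDegree Z) (i : V)
    {w : V → Matrix (Fin d × Fin d) (Fin d × Fin d) ℂ}
    (hw : ∀ j, G.Adj i j → h.term {i, j} = onPair i j (w j)) {J : ℝ}
    (hJ : ∀ j, G.Adj i j → ‖h.term {i, j}‖ ≤ J) :
    ‖(1 / (Z : ℂ)) * ∑ j ∈ G.neighborFinset i, meanField Ω i j (w j) -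
        (1 / (Z : ℂ)) * ∑ j ∈ G.neighborFinset i, expectation Ω (h.term {i, j})‖ ≤
      d ^ 4 * Real.sqrt (8 * g) * (J / Real.sqrt (Z * δE)) := by
  rcases Nat.eq_zero_or_pos Z with rfl | hZ
  · simp
  have hcard : (G.neighborFinset i).card = Z := hG i
  have hJ0 : 0 ≤ J := by
    obtain ⟨j, hj⟩ := Finset.card_pos.1 (hcard ▸ hZ)
    exact (norm_nonneg _).trans (hJ j (by simpa using hj))
  have hsum : ‖∑ j ∈ G.neighborFinset i, (meanField Ω i j (w j) - expectation Ω (h.term {i, j}))‖ ≤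
      J * (d ^ 4 * Real.sqrt (8 * g) * Real.sqrt (Z / δE)) := by
    have h1 := hΩ.sum_sum_norm_entry_le (L := G.neighborFinset i) (i := i) (by simp)
    rw [hcard, show (4 * (2 : ℕ) * g : ℝ) = 8 * g by push_cast; ring] at h1
    refine le_trans ?_ (mul_le_mul_of_nonneg_left h1 hJ0)
    rw [Finset.mul_sum]
    refine norm_sum_le_of_le _ fun j hj => ?_
    have hadj : G.Adj i j := by simpa using hj
    rw [hw j hadj]
    refine (norm_meanField_sub_expectation_le Ω hadj.ne (w j)).trans ?_
    exact mul_le_mul_of_nonneg_right (hw j hadj ▸ hJ j hadj) (by positivity)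
  rw [← mul_sub, ← Finset.sum_sub_distrib, norm_mul]
  have hZn : ‖1 / (Z : ℂ)‖ = 1 / Z := by simp
  have hsqrt : 1 / (Z : ℝ) * Real.sqrt (Z / δE) = 1 / Real.sqrt (Z * δE) := by
    have hZ' : (0 : ℝ) < Z := Nat.cast_pos.2 hZ
    have hδ := hΩ.gap_pos
    have hz := Real.sqrt_pos.2 hZ'
    have hd := Real.sqrt_pos.2 hδ
    rw [Real.sqrt_div hZ'.le, Real.sqrt_mul hZ'.le]
    field_simp
    rw [Real.sq_sqrt hZ'.le]
  rw [hZn]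
  calc _ ≤ 1 / (Z : ℝ) * (J * (d ^ 4 * Real.sqrt (8 * g) * Real.sqrt (Z / δE))) :=
        mul_le_mul_of_nonneg_left hsum (by positivity)
    _ = d ^ 4 * Real.sqrt (8 * g) * (J * (1 / (Z : ℝ) * Real.sqrt (Z / δE))) := by ring
    _ = _ := by rw [hsqrt, mul_one_div]

end Correlation

end SpinSystem

theorem mainTheorem5 (d k : ℕ) (g : ℝ) :
    (∃ C : ℝ, 0 < C ∧
      ∀ (V : Type*) [Fintype V] [DecidableEq V]
        (h : SpinSystem.LocalHamiltonian V d k g)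
        (Ω : (V → Fin d) → ℂ) (E₀ δE : ℝ),
        SpinSystem.IsUniqueGroundState h.total Ω E₀ δE →
        ∀ (L : Finset V) (i : V), i ∉ L →
          ∑ j ∈ L, ‖SpinSystem.rho₂ Ω i j -
              (SpinSystem.rho₁ Ω i ⊗ₖ SpinSystem.rho₁ Ω j)‖
            ≤ C * Real.sqrt ((L.card : ℝ) / δE)) ∧
    (∃ C : ℝ, 0 < C ∧
      ∀ (V : Type*) [Fintype V] [DecidableEq V]
        (G : SimpleGraph V) [DecidableRel G.Adj] (Z : ℕ),
        G.IsRegularOfDegree Z →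
        ∀ (h : SpinSystem.LocalHamiltonian V d 2 g),
        h.IsNearestNeighbour G →
        ∀ (Ω : (V → Fin d) → ℂ) (E₀ δE : ℝ),
        SpinSystem.IsUniqueGroundState h.total Ω E₀ δE →
        ∀ (i : V) (w : V → Matrix (Fin d × Fin d) (Fin d × Fin d) ℂ),
        (∀ j, G.Adj i j → h.term {i, j} = SpinSystem.onPair i j (w j)) →
          ‖(1 / (Z : ℂ)) * ∑ j ∈ G.neighborFinset i, SpinSystem.meanField Ω i j (w j) -
              (1 / (Z : ℂ)) * ∑ j ∈ G.neighborFinset i,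
                SpinSystem.expectation Ω (h.term {i, j})‖
            ≤ C * (1 / Real.sqrt ((Z : ℝ) * δE)) ∧
          ∀ J : ℝ, (∀ j, G.Adj i j → ‖h.term {i, j}‖ ≤ J) →
            ‖(1 / (Z : ℂ)) * ∑ j ∈ G.neighborFinset i, SpinSystem.meanField Ω i j (w j) -
                (1 / (Z : ℂ)) * ∑ j ∈ G.neighborFinset i,
                  SpinSystem.expectation Ω (h.term {i, j})‖
              ≤ C * (J / Real.sqrt ((Z : ℝ) * δE))) := by
  constructor
  · refine ⟨d ^ 4 * Real.sqrt (4 * k * g) + 1, by positivity, ?_⟩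
    intro V _ _ h Ω E₀ δE hΩ L i hi
    calc _ ≤ _ := Finset.sum_le_sum fun j _ => SpinSystem.norm_le_sum_norm_entries _
      _ ≤ _ := hΩ.sum_sum_norm_entry_le hi
      _ ≤ _ := mul_le_mul_of_nonneg_right (by linarith) (Real.sqrt_nonneg _)
  · have hc : 0 ≤ d ^ 4 * Real.sqrt (8 * g) := by positivity
    refine ⟨d ^ 4 * Real.sqrt (8 * g) * (|g| + 1) + 1, by positivity, ?_⟩
    intro V _ _ G _ Z hG h _ Ω E₀ δE hΩ i w hw
    have hs := Real.sqrt_nonneg ((Z : ℝ) * δE)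
    constructor
    · refine (hΩ.norm_energy_density_sub_le hG i hw (J := g)
        fun j _ => h.norm_term_le (i := i) (by simp)).trans ?_
      rw [div_eq_mul_one_div g, ← mul_assoc]
      refine mul_le_mul_of_nonneg_right ?_ (by positivity)
      nlinarith [le_abs_self g]
    · intro J hJ
      refine (hΩ.norm_energy_density_sub_le hG i hw hJ).trans ?_
      rcases Nat.eq_zero_or_pos Z with rfl | hZ
      · -- Both sides vanish: division by zero gives zero.
        simp
      have hJ0 : 0 ≤ J := by
        obtain ⟨j, hj⟩ := Finset.card_pos.1 ((hG i : (G.neighborFinset i).card = Z) ▸ hZ)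
        exact (norm_nonneg _).trans (hJ j (by simpa using hj))
      refine mul_le_mul_of_nonneg_right ?_ (by positivity)
      nlinarith [abs_nonneg g]
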